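/- \textbf{Theorem (Congruence Theorem).} Let $F$ be a field with a Henselian valuation $w$ (that is, $w$ has, up to equivalence, a unique extension to every algebraic field extension of $F$). Let $D$ be a division algebra with center $F$ and $[D:F]=n^2<\infty$, so that $n$ is the index of $D$, equipped with the valuation $v$ extending $w$. Let $V_D$ (resp. $V_F$) be the valuation ring of $v$ (resp. $w$), $M_D$ (resp. $M_F$) its maximal ideal, and $\overline D=V_D/M_D$, $\overline F=V_F/M_F$ the residue division rings. Assume that $D$ is tame, i.e. the field extension $Z(\overline D)/\overline F$ is separable and $\operatorname{char}(\overline F)\nmid n$. Then $$1+M_D=(1+M_F)\,[D^*,1+M_D]\qquad\text{and}\qquad (1+M_D)\cap D^{(1)}=[D^*,1+M_D],$$ where $D^{(1)}$ is the kernel of the reduced norm $\operatorname{Nrd}_D\colon D^*\to F^*$ and $[D^*,1+M_D]$ is the subgroup of $D^*$ generated by the commutators $a^{-1}b^{-1}ab$ with $a\in D^*$, $b\in 1+M_D$. -/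

import Mathlib

open scoped TensorProduct Pointwise

namespace ValuedDivision

universe u u' u''

/-! ### Splitting over the algebraic closure, index and reduced norm -/

section ReducedNorm

variable {F : Type u} [Field F] {D : Type u'} [DivisionRing D] [Algebra F D]

/-- Right multiplication by an element of `D` acts on the coordinates of an element of `D ⊗ L`
with respect to a basis of `L` by right multiplication. -/
theorem basis_repr_mul_tmul_one {L : Type u''} [Field L] [Algebra F L] {ι : Type*}
    (b : Module.Basis ι F L) (y : D ⊗[F] L) (e : D) (j : ι) :
    (Algebra.TensorProduct.basis D b).repr (y * (e ⊗ₜ[F] (1 : L))) j =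
      (Algebra.TensorProduct.basis D b).repr y j * e := by
  induction y using TensorProduct.induction_on with
  | zero => simp
  | tmul a l =>
    simp [Algebra.TensorProduct.basis_repr_tmul, mul_assoc, Algebra.commutes]
  | add x y hx hy => simp [add_mul, hx, hy]

theorem isSimpleRing_tensor [Algebra.IsCentral F D] (L : Type u'') [Field L] [Algebra F L] :
    IsSimpleRing (D ⊗[F] L) := by
  classical
  let b := Module.Basis.ofVectorSpace F L
  let B := Algebra.TensorProduct.basis D b
  have key : ∀ (I : TwoSidedIdeal (D ⊗[F] L)) (n : ℕ) (x : D ⊗[F] L), x ∈ I → x ≠ 0 →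
      (B.repr x).support.card = n → (1 : D ⊗[F] L) ∈ I := by
    intro I n
    induction n using Nat.strong_induction_on with
    | _ n ih =>
      intro x hx hx0 hn
      have hr : B.repr x ≠ 0 := fun h => hx0 (by simpa using h)
      obtain ⟨i, hi⟩ := Finsupp.support_nonempty_iff.mpr hr
      have hd : B.repr x i ≠ 0 := Finsupp.mem_support_iff.mp hi
      set d := B.repr x i with hd_def
      set y : D ⊗[F] L := (d⁻¹ ⊗ₜ[F] (1 : L)) * x with hy
      have hsm : ∀ (e : D) (z : D ⊗[F] L), (e ⊗ₜ[F] (1 : L)) * z = e • z := by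
        intro e z
        induction z using TensorProduct.induction_on with
        | zero => simp
        | tmul a l => simp [TensorProduct.smul_tmul']
        | add x y hx hy => rw [mul_add, smul_add, hx, hy]
      have hyI : y ∈ I := I.mul_mem_left _ _ hx
      have hyr : ∀ j, B.repr y j = d⁻¹ * B.repr x j := by
        intro j
        rw [hy, hsm, map_smul, Finsupp.smul_apply, smul_eq_mul]
      have hyi : B.repr y i = 1 := by rw [hyr, ← hd_def, inv_mul_cancel₀ hd]
      by_cases hc : ∀ e : D, (e ⊗ₜ[F] (1 : L)) * y - y * (e ⊗ₜ[F] (1 : L)) = 0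
      · have hcen : ∀ j, ∃ c : F, algebraMap F D c = B.repr y j := by
          intro j
          have : B.repr y j ∈ Subalgebra.center F D := by
            rw [Subalgebra.mem_center_iff]
            intro e
            have h1 := congrArg (fun z => B.repr z j) (hc e)
            simp only [hsm, map_sub, Finsupp.sub_apply, map_smul, Finsupp.smul_apply,
              smul_eq_mul, map_zero, Finsupp.zero_apply] at h1
            rw [basis_repr_mul_tmul_one] at h1
            exact sub_eq_zero.mp h1
          exact Algebra.mem_bot.mp (Algebra.IsCentral.out this)
        choose c hcc using hcen
        have hyl : y = (1 : D) ⊗ₜ[F] (∑ j ∈ (B.repr y).support, c j • b j) := by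
          conv_lhs => rw [← B.linearCombination_repr y]
          rw [Finsupp.linearCombination_apply, Finsupp.sum, TensorProduct.tmul_sum]
          refine Finset.sum_congr rfl fun j _ => ?_
          rw [← hcc j, Algebra.TensorProduct.basis_apply, algebraMap_smul,
            TensorProduct.tmul_smul]
        set l := ∑ j ∈ (B.repr y).support, c j • b j
        have hl : l ≠ 0 := by
          intro h
          rw [h, TensorProduct.tmul_zero] at hyl
          rw [hyl] at hyi
          simp at hyi
        have : y * ((1 : D) ⊗ₜ[F] l⁻¹) = 1 := by
          rw [hyl, Algebra.TensorProduct.tmul_mul_tmul, mul_inv_cancel₀ hl, one_mul]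
          rfl
        rw [← this]
        exact I.mul_mem_right _ _ hyI
      · push Not at hc
        obtain ⟨e, he⟩ := hc
        refine ih _ ?_ _ (I.sub_mem (I.mul_mem_left _ _ hyI) (I.mul_mem_right _ _ hyI)) he rfl
        rw [← hn]
        refine Finset.card_lt_card ((Finset.ssubset_iff_of_subset ?_).mpr ⟨i, hi, ?_⟩)
        · intro j hj
          rw [Finsupp.mem_support_iff] at hj ⊢
          intro h
          apply hj
          rw [map_sub, Finsupp.sub_apply, hsm, map_smul, Finsupp.smul_apply,
            basis_repr_mul_tmul_one]
          change e • B.repr y j - B.repr y j * e = 0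
          rw [hyr, h]
          simp
        · rw [Finsupp.mem_support_iff, not_not, map_sub, Finsupp.sub_apply, hsm, map_smul,
            Finsupp.smul_apply, basis_repr_mul_tmul_one]
          change e • B.repr y i - B.repr y i * e = 0
          rw [hyi]
          simp
  have : Nontrivial (D ⊗[F] L) :=
    (Algebra.TensorProduct.includeRight_injective (R := F) (A := D) (B := L)
      (algebraMap F D).injective).nontrivial
  refine ⟨⟨fun I => ?_⟩⟩
  by_cases hI : I = ⊥
  · exact Or.inl hI
  · right
    obtain ⟨x, hx, hx0⟩ : ∃ x ∈ I, x ≠ 0 := by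
      by_contra! h
      exact hI (le_bot_iff.mp fun x hx => by
        rw [TwoSidedIdeal.mem_bot]; exact h x hx)
    exact I.one_mem_iff.mp (key I _ x hx hx0 rfl)

variable (F D)

/-- The index `√[D : F]` of a division algebra `D` that is finite dimensional over its center `F`
(where `[D : F]` is a perfect square). -/
noncomputable def index : ℕ := Nat.sqrt (Module.finrank F D)

theorem exists_splitting [Algebra.IsCentral F D] [FiniteDimensional F D] :
    Nonempty (AlgebraicClosure F ⊗[F] D ≃ₐ[AlgebraicClosure F]
      Matrix (Fin (index F D)) (Fin (index F D)) (AlgebraicClosure F)) := by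
  have h1 : IsSimpleRing (D ⊗[F] AlgebraicClosure F) := isSimpleRing_tensor _
  have h2 : IsSimpleRing (AlgebraicClosure F ⊗[F] D) :=
    IsSimpleRing.of_ringEquiv (Algebra.TensorProduct.comm F D (AlgebraicClosure F)).toRingEquiv h1
  obtain ⟨n, _, ⟨e⟩⟩ := IsSimpleRing.exists_algEquiv_matrix_of_isAlgClosed
    (AlgebraicClosure F) (AlgebraicClosure F ⊗[F] D)
  have hn : Module.finrank F D = n * n := by
    rw [← Module.finrank_baseChange (R := AlgebraicClosure F), e.toLinearEquiv.finrank_eq,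
      Module.finrank_matrix]
    simp
  have : index F D = n := by rw [index, hn, Nat.sqrt_eq]
  rw [this]
  exact ⟨e⟩

/-- The reduced norm `a ↦ det (φ (1 ⊗ a))`, where `φ` is an isomorphism of `F_alg ⊗ D` with the
algebra of `n × n` matrices over an algebraic closure `F_alg` of `F`, and `n` is the index of `D`.
The value does not depend on `φ` and lies in the subfield `F` of `F_alg`; we record it as an element
of `F_alg`, which does not change the kernel. -/
noncomputable def reducedNorm [Algebra.IsCentral F D] [FiniteDimensional F D] :
    D →* AlgebraicClosure F :=
  Matrix.detMonoidHom.comp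
    (((Classical.choice (exists_splitting F D)).toAlgHom.toRingHom.comp
      (Algebra.TensorProduct.includeRight : D →ₐ[F] AlgebraicClosure F ⊗[F] D).toRingHom).toMonoidHom)

/-- The group `D⁽¹⁾`, the kernel of the reduced norm on `D^*`. -/
noncomputable def reducedNormKer [Algebra.IsCentral F D] [FiniteDimensional F D] : Subgroup Dˣ :=
  (Units.map (reducedNorm F D)).ker

end ReducedNorm

/-! ### Valuations

Valuations are written multiplicatively, as in Mathlib: `v a ≤ 1` says that `a` is integral
and `v a < 1` that `a` lies in the maximal ideal. -/

section Residue

variable {K : Type u} [DivisionRing K] {Γ : Type u'} [LinearOrderedCommGroupWithZero Γ]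

/-- The maximal ideal `M_K = {a | v a < 1}` of the valuation ring of a valued division ring. -/
def maxIdeal (v : Valuation K Γ) : Ideal v.integer where
  carrier := {a | v (a : K) < 1}
  zero_mem' := by simp
  add_mem' := fun {a b} ha hb => v.map_add_lt ha hb
  smul_mem' := fun c a ha => by
    change v ((c : K) * (a : K)) < 1
    rw [map_mul]
    exact (mul_le_of_le_one_left' c.2).trans_lt ha

instance (v : Valuation K Γ) : (maxIdeal v).IsTwoSided where
  mul_mem_of_left {a} c ha := by
    change v ((a : K) * (c : K)) < 1
    rw [map_mul]
    exact (mul_le_of_le_one_right' c.2).trans_lt ha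

/-- The residue (division) ring of a valued division ring. -/
abbrev Residue (v : Valuation K Γ) : Type u := v.integer ⧸ maxIdeal v

/-- The subgroup `1 + M_K` of `K^*`. -/
def oneAddMaxIdeal (v : Valuation K Γ) : Subgroup Kˣ where
  carrier := {a | v ((a : K) - 1) < 1}
  one_mem' := by simp
  mul_mem' := by
    intro a b ha hb
    change v (((a * b : Kˣ) : K) - 1) < 1
    have hva : v (a : K) = 1 := by
      have := v.map_one_add_of_lt ha
      rwa [add_sub_cancel] at this
    have : ((a * b : Kˣ) : K) - 1 = a * ((b : K) - 1) + ((a : K) - 1) := by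
      push_cast; noncomm_ring
    rw [this]
    refine v.map_add_lt ?_ ha
    rw [map_mul, hva, one_mul]
    exact hb
  inv_mem' := by
    intro a ha
    change v (((a⁻¹ : Kˣ) : K) - 1) < 1
    have hva : v (a : K) = 1 := by
      have := v.map_one_add_of_lt ha
      rwa [add_sub_cancel] at this
    have : ((a⁻¹ : Kˣ) : K) - 1 = -(((a⁻¹ : Kˣ) : K) * ((a : K) - 1)) := by
      rw [mul_sub, Units.inv_mul]; simp
    rw [this, Valuation.map_neg, map_mul, Units.val_inv_eq_inv_val, map_inv₀, hva, inv_one,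
      one_mul]
    exact ha

end Residue

section Extension

variable {F : Type u} [Field F] {Γ₀ : Type u'} [LinearOrderedCommGroupWithZero Γ₀]

/-- A valuation `w` on a field `F` is Henselian if it has a unique extension (up to equivalence
of valuations) to every algebraic field extension of `F`. Every algebraic extension embeds into
the algebraic closure, and every valuation is equivalent to one whose value group is a quotient of
the unit group of the field, so the universe of `F` is large enough. -/
def IsHenselian (w : Valuation F Γ₀) : Prop :=
  ∀ (L : Type u) [Field L] [Algebra F L] [Algebra.IsAlgebraic F L],
    (∃ (Γ : Type u) (_ : LinearOrderedCommGroupWithZero Γ) (v : Valuation L Γ),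
      w.HasExtension v) ∧
    ∀ (Γ₁ Γ₂ : Type u) [LinearOrderedCommGroupWithZero Γ₁] [LinearOrderedCommGroupWithZero Γ₂]
      (v₁ : Valuation L Γ₁) (v₂ : Valuation L Γ₂),
      w.HasExtension v₁ → w.HasExtension v₂ → v₁.IsEquiv v₂

variable {D : Type u''} [DivisionRing D] [Algebra F D]
  {Γ₁ : Type*} [LinearOrderedCommGroupWithZero Γ₁]

/-- If `v` extends `w`, the residue ring of `v` is an algebra over the residue field of `w`. -/
instance residueAlgebra (w : Valuation F Γ₀) (v : Valuation D Γ₁) [w.HasExtension v] :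
    Algebra (Residue w) (Residue v) :=
  RingHom.toAlgebra'
    (Ideal.Quotient.lift (maxIdeal w)
      ((Ideal.Quotient.mk (maxIdeal v)).comp (algebraMap w.integer v.integer))
      (fun a ha => Ideal.Quotient.eq_zero_iff_mem.mpr
        ((Valuation.HasExtension.val_map_lt_one_iff w v (a : F)).mpr ha)))
    (by
      intro c x
      obtain ⟨c, rfl⟩ := Ideal.Quotient.mk_surjective c
      obtain ⟨x, rfl⟩ := Ideal.Quotient.mk_surjective x
      simp only [Ideal.Quotient.lift_mk, RingHom.comp_apply]
      rw [← map_mul, ← map_mul, Algebra.commutes])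

/-- Let `v` be a valuation on `D` that extends the valuation `w` on `F`. Then `D` is tame if the
center of the residue division ring of `D` is separable over the residue field of `F`, whose
characteristic does not divide the index of `D`. -/
def IsTame (w : Valuation F Γ₀) (v : Valuation D Γ₁) [w.HasExtension v] : Prop :=
  Algebra.IsSeparable (Residue w) (Subalgebra.center (Residue w) (Residue v)) ∧
    ¬ ringChar (Residue w) ∣ index F D

end Extension

end ValuedDivision

/-! Write H for [D^*, 1 + M_D]. Modulo H an element a of 1 + M_D agrees with all its conjugates. By
Wedderburn (`exists_minpoly_eq_prod`) the minimal polynomial of a over F splits over D into m linear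
factors, m its degree, with conjugates of a as roots. Comparing constant terms, a product of m
conjugates of a is some c in F, necessarily in 1 + M_F, so a^m ≡ c mod H
(`exists_pow_natDegree_div_mem`).

Since n is a unit of V_F, so is [D : F] = n^2, and Hensel's lemma in F(a) gives a = b^(n^2) with b
in 1 + M_D (`IsHenselian.exists_pow_eq_of_mem_oneAddMaxIdeal`). The degree of b divides n^2, so a is
congruent to a power of an element of 1 + M_F: this is the first equality.

For the second, let a = c h with c in 1 + M_F, h in H and Nrd a = 1. Then Nrd h = 1, so c^n = Nrd c
= 1, and c = 1 because 1 + M_F has no nontrivial n-th root of unity (`eq_one_of_pow_eq_one`). -/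

namespace ValuedDivision

/-! ### Wedderburn's factorization of minimal polynomials over D -/

section Wedderburn

open Polynomial

variable {F : Type*} [Field F] {D : Type*} [DivisionRing D] [Algebra F D]

/-- The action of the polynomial ring `D[X]` on `D`, where `D` acts by left multiplication and `X`
by right multiplication by `a`. -/
noncomputable def polyAct (F : Type*) [Field F] {D : Type*} [DivisionRing D] [Algebra F D] (a : D) :
    D[X] →+* Module.End F D :=
  eval₂RingHom' (Algebra.lmul F D).toRingHom (LinearMap.mulRight F a) fun c =>
    LinearMap.ext fun d => by simp [mul_assoc]

theorem polyAct_C (a c d : D) : polyAct F a (C c) d = c * d := by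
  simp [polyAct, eval₂RingHom']

theorem polyAct_X (a d : D) : polyAct F a X d = d * a := by
  simp [polyAct, eval₂RingHom']

theorem polyAct_map (a d : D) (f : F[X]) :
    polyAct F a (f.map (algebraMap F D)) d = d * aeval a f := by
  induction f using Polynomial.induction_on' generalizing d with
  | add p q hp hq => simp [hp, hq, mul_add]
  | monomial n c =>
    induction n generalizing d with
    | zero =>
      rw [map_monomial, monomial_zero_left, polyAct_C, monomial_zero_left, aeval_C,
        Algebra.commutes]
    | succ n ih =>
      rw [← monomial_mul_X, Polynomial.map_mul, map_X, map_mul, Module.End.mul_apply, polyAct_X,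
        ih, ← X_mul, map_mul, aeval_X, mul_assoc]

/-- A nonzero polynomial over `D` that acts as zero has at least the degree of the minimal
polynomial over the center. -/
theorem natDegree_minpoly_le_of_polyAct_eq_zero [Algebra.IsCentral F D] (a : D) {h : D[X]}
    (h0 : h ≠ 0) (hh : polyAct F a h = 0) : (minpoly F a).natDegree ≤ h.natDegree := by
  induction hn : h.natDegree using Nat.strong_induction_on generalizing h with
  | _ n ih =>
    set p : D[X] := C h.leadingCoeff⁻¹ * h with hp
    have hlc : h.leadingCoeff ≠ 0 := leadingCoeff_ne_zero.mpr h0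
    have hpn : p.natDegree = n := by
      rw [hp, natDegree_C_mul (inv_ne_zero hlc), hn]
    have hpc : p.coeff n = 1 := by
      rw [hp, coeff_C_mul, ← hn, coeff_natDegree, inv_mul_cancel₀ hlc]
    have hpa : polyAct F a p = 0 := by rw [hp, map_mul, hh, mul_zero]
    have hp0 : p ≠ 0 := by rintro h; simp [h] at hpc
    -- The kernel of the action is a two-sided ideal, so it contains every commutator of p with a
    -- constant. If all vanish, p has central coefficients and comes from F[X]; otherwise p being
    -- monic makes the top terms cancel and the degree drops.
    by_cases hc : ∀ e : D, C e * p - p * C e = 0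
    · have hl : p ∈ lifts (algebraMap F D) := by
        rw [lifts_iff_coeff_lifts]
        intro i
        have hi : p.coeff i ∈ Subalgebra.center F D := by
          rw [Subalgebra.mem_center_iff]
          intro e
          have := congrArg (fun q => coeff q i) (hc e)
          simpa [sub_eq_zero] using this
        exact Algebra.mem_bot.mp (Algebra.IsCentral.out hi)
      obtain ⟨q, hq⟩ := (mem_lifts p).mp hl
      have hqa : aeval a q = 0 := by
        have := polyAct_map a 1 q
        rwa [hq, hpa, LinearMap.zero_apply, one_mul, eq_comm] at this
      have hq0 : q ≠ 0 := by rintro rfl; exact hp0 (by simpa using hq.symm)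
      have := natDegree_le_natDegree (minpoly.degree_le_of_ne_zero F a hq0 hqa)
      rwa [← natDegree_map (algebraMap F D) (p := q), hq, hpn] at this
    · push Not at hc
      obtain ⟨e, he⟩ := hc
      have hle : (C e * p - p * C e).natDegree ≤ n := by
        refine (natDegree_sub_le _ _).trans (max_le ?_ ?_)
        · exact (natDegree_C_mul_le _ _).trans hpn.le
        · exact (natDegree_mul_C_le _ _).trans hpn.le
      have hlt : (C e * p - p * C e).natDegree < n := by
        refine lt_of_le_of_ne hle fun heq => he ?_
        rw [← leadingCoeff_eq_zero, leadingCoeff, heq]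
        simp [hpc]
      exact (ih _ hlt he (by simp [hpa]) rfl).trans hlt.le

theorem exists_eq_mul_X_sub_C_add_C (x : D) (g : D[X]) :
    ∃ (q : D[X]) (r : D), g = q * (X - C x) + C r := by
  induction g using Polynomial.induction_on' with
  | add p q hp hq =>
    obtain ⟨q₁, r₁, h₁⟩ := hp
    obtain ⟨q₂, r₂, h₂⟩ := hq
    exact ⟨q₁ + q₂, r₁ + r₂, by
      conv_lhs => rw [h₁, h₂]
      rw [C_add, add_mul]; abel⟩
  | monomial n c =>
    induction n with
    | zero => exact ⟨0, c, by simp⟩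
    | succ n ih =>
      obtain ⟨q, r, h⟩ := ih
      refine ⟨q * X + C r, r * x, ?_⟩
      rw [← monomial_mul_X, h, C_mul, add_mul, add_mul, mul_assoc, ← X_mul, mul_assoc, add_assoc,
        mul_sub (C r), sub_add_cancel]

theorem monic_and_natDegree_prod_X_sub_C {ι : Type*} (f : ι → D) (l : List ι) :
    (l.map fun u => X - C (f u)).prod.Monic ∧
      (l.map fun u => X - C (f u)).prod.natDegree = l.length := by
  induction l with
  | nil => simp
  | cons u l ih =>
    rw [List.map_cons, List.prod_cons]
    refine ⟨(monic_X_sub_C _).mul ih.1, ?_⟩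
    rw [(monic_X_sub_C _).natDegree_mul ih.1, ih.2, natDegree_X_sub_C, List.length_cons, add_comm]

/-- The minimal polynomial of `a` is a left multiple of a product of `k` linear factors whose roots
are conjugates of `a`, for `k` up to its degree. -/
theorem exists_minpoly_eq_mul_prod [Algebra.IsCentral F D] (a : D) (k : ℕ)
    (hk : k ≤ (minpoly F a).natDegree) :
    ∃ (g : D[X]) (l : List Dˣ), l.length = k ∧ (minpoly F a).map (algebraMap F D) =
      g * (l.map fun u : Dˣ => X - C ((u : D) * a * (u : D)⁻¹)).prod := by
  induction k with
  | zero => exact ⟨(minpoly F a).map (algebraMap F D), [], by simp⟩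
  | succ k ih =>
    obtain ⟨g, l, hl, hg⟩ := ih (by omega)
    set h := (l.map fun u : Dˣ => X - C ((u : D) * a * (u : D)⁻¹)).prod
    obtain ⟨hmon, hdeg⟩ := monic_and_natDegree_prod_X_sub_C
      (fun u : Dˣ => (u : D) * a * (u : D)⁻¹) l
    have hact : polyAct F a h ≠ 0 := fun h0 => by
      have := natDegree_minpoly_le_of_polyAct_eq_zero a hmon.ne_zero h0
      omega
    obtain ⟨d, hd⟩ : ∃ d, polyAct F a h d ≠ 0 := by
      by_contra! H
      exact hact (LinearMap.ext H)
    set u := polyAct F a h d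
    -- The minimal polynomial g * h kills d, so g kills u = h·d. As X - C (u a u⁻¹) also kills u,
    -- the remainder r of g satisfies r u = 0.
    have hgu : polyAct F a g u = 0 := by
      have := polyAct_map a d (minpoly F a)
      rwa [hg, map_mul, Module.End.mul_apply, minpoly.aeval, mul_zero] at this
    obtain ⟨q, r, hqr⟩ := exists_eq_mul_X_sub_C_add_C (u * a * u⁻¹) g
    have hr : r = 0 := by
      rw [hqr, map_add, map_mul, LinearMap.add_apply, Module.End.mul_apply, map_sub,
        LinearMap.sub_apply, polyAct_X, polyAct_C, polyAct_C, mul_assoc, inv_mul_cancel₀ hd,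
        mul_one, sub_self, map_zero, zero_add] at hgu
      exact (mul_eq_zero.mp hgu).resolve_right hd
    refine ⟨q, Units.mk0 u hd :: l, by simp [hl], ?_⟩
    rw [List.map_cons, List.prod_cons, ← mul_assoc, hg, hqr, hr, C_0, add_zero, Units.val_mk0]

/-- Wedderburn's factorization theorem. -/
theorem exists_minpoly_eq_prod [Algebra.IsCentral F D] [FiniteDimensional F D] (a : D) :
    ∃ l : List Dˣ, l.length = (minpoly F a).natDegree ∧ (minpoly F a).map (algebraMap F D) =
      (l.map fun u : Dˣ => X - C ((u : D) * a * (u : D)⁻¹)).prod := by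
  obtain ⟨g, l, hl, hg⟩ := exists_minpoly_eq_mul_prod (F := F) a _ le_rfl
  refine ⟨l, hl, ?_⟩
  set h := (l.map fun u : Dˣ => X - C ((u : D) * a * (u : D)⁻¹)).prod
  have hm : (minpoly F a).Monic := minpoly.monic (Algebra.IsIntegral.isIntegral a)
  have hfm := hm.map (algebraMap F D)
  obtain ⟨hlc, hd⟩ := monic_and_natDegree_prod_X_sub_C
    (fun u : Dˣ => (u : D) * a * (u : D)⁻¹) l
  have hgl : g.leadingCoeff = 1 := by
    have := congrArg leadingCoeff hg
    rwa [leadingCoeff_mul, hlc.leadingCoeff, mul_one, hfm.leadingCoeff, eq_comm] at this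
  have hgd : g.natDegree = 0 := by
    have := congrArg natDegree hg
    rw [hm.natDegree_map, Monic.natDegree_mul hgl hlc, hd, hl] at this
    omega
  rw [hg, eq_one_of_monic_natDegree_zero hgl hgd, one_mul]

/-- The product of suitable conjugates of `a`, as many as the degree of `a` over the center, lies in
the center. -/
theorem exists_prod_conj_eq_algebraMap [Algebra.IsCentral F D] [FiniteDimensional F D] (a : Dˣ) :
    ∃ (l : List Dˣ) (c : F), l.length = (minpoly F (a : D)).natDegree ∧
      ((l.map fun u => u * a * u⁻¹).prod : D) = algebraMap F D c := by
  obtain ⟨l, hl, h⟩ := exists_minpoly_eq_prod (F := F) (a : D)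
  refine ⟨l, (-1) ^ l.length * (minpoly F (a : D)).coeff 0, hl, ?_⟩
  have key : ∀ l : List Dˣ,
      (l.map fun u : Dˣ => X - C ((u : D) * a * (u : D)⁻¹)).prod.coeff 0 =
        (-1) ^ l.length * ((l.map fun u => u * a * u⁻¹).prod : D) := by
    intro l
    induction l with
    | nil => simp
    | cons u l ih =>
      rw [List.map_cons, List.prod_cons, mul_coeff_zero, ih, List.map_cons, List.prod_cons,
        List.length_cons, Units.val_mul, pow_succ, ← mul_assoc,
        ((Commute.neg_one_left _).pow_left _).eq.symm]
      simp [mul_assoc]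
  have h1 := congrArg (fun q => coeff q 0) h
  simp only [key, coeff_map] at h1
  rw [map_mul, h1, map_pow, map_neg, map_one, ← mul_assoc, ← pow_add,
    Even.neg_one_pow ⟨_, rfl⟩, one_mul]

end Wedderburn

/-! ### Hensel's lemma for N-th roots, with N a unit -/

section Hensel

open Polynomial

universe v₁ v₂

/-- In z^N - 1 = (1 + z + ... + z^(N-1)) (z - 1) the first factor is congruent to the unit N, hence
nonzero. -/
theorem eq_one_of_pow_eq_one {L : Type*} [Field L] {Γ : Type*} [LinearOrderedCommGroupWithZero Γ]
    (v : Valuation L Γ) {N : ℕ} (hN : v (N : L) = 1) {z : Lˣ} (hz : z ∈ oneAddMaxIdeal v)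
    (h : z ^ N = 1) : z = 1 := by
  have hg := geom_sum_mul (z : L) N
  rw [← Units.val_pow_eq_pow_val, h, Units.val_one, sub_self, mul_eq_zero] at hg
  rcases hg with hg | hg
  · exfalso
    have hlt : v (∑ i ∈ Finset.range N, ((z : L) ^ i - 1)) < 1 :=
      v.map_sum_lt one_ne_zero fun i _ => by
        have := pow_mem hz i
        simpa using! this
    rw [Finset.sum_sub_distrib, hg] at hlt
    simp [Valuation.map_neg, hN] at hlt
  · exact Units.ext (sub_eq_zero.mp hg)

/-- Evaluating X^N - a at 1 gives 1 - a = ∏ (1 - b) over the N-th roots b of a; if every factor had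
value at least 1, so would 1 - a. -/
theorem exists_pow_eq_of_isAlgClosed {L : Type*} [Field L] [IsAlgClosed L] {Γ : Type*}
    [LinearOrderedCommGroupWithZero Γ] (v : Valuation L Γ) {N : ℕ} (hN : N ≠ 0) {a : L}
    (ha : v (a - 1) < 1) : ∃ b : L, b ^ N = a ∧ v (b - 1) < 1 := by
  have hm : (X ^ N - C a).Monic := monic_X_pow_sub_C a hN
  have hs := IsAlgClosed.splits (X ^ N - C a)
  have he := hs.eval_eq_prod_roots_of_monic hm 1
  by_contra! H
  have h1 : 1 ≤ v (((X ^ N - C a).roots.map fun b => 1 - b).prod) := by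
    rw [map_multiset_prod, Multiset.map_map]
    refine Multiset.one_le_prod_of_one_le fun x hx => ?_
    obtain ⟨b, hb, rfl⟩ := Multiset.mem_map.mp hx
    have hb' : b ^ N = a := by
      simpa [sub_eq_zero] using (mem_roots hm.ne_zero).mp hb
    rw [Function.comp_apply, Valuation.map_sub_swap]
    exact H b hb'
  rw [← he] at h1
  simp only [eval_sub, eval_pow, eval_X, one_pow, eval_C] at h1
  rw [Valuation.map_sub_swap] at h1
  exact h1.not_gt ha

/-- Removes the universe restriction on value groups: each valuation is replaced by that of its
valuation subring, whose value group lives in the universe of L. -/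
theorem IsHenselian.isEquiv {F : Type v₁} [Field F] {Γ₀ : Type*}
    [LinearOrderedCommGroupWithZero Γ₀] {w : Valuation F Γ₀} (hw : IsHenselian w)
    {L : Type v₁} [Field L] [Algebra F L] [Algebra.IsAlgebraic F L] {Γ₁ Γ₂ : Type*}
    [LinearOrderedCommGroupWithZero Γ₁] [LinearOrderedCommGroupWithZero Γ₂]
    {v₁ : Valuation L Γ₁} {v₂ : Valuation L Γ₂} (h₁ : w.HasExtension v₁)
    (h₂ : w.HasExtension v₂) : v₁.IsEquiv v₂ := by
  have e₁ := v₁.isEquiv_valuation_valuationSubring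
  have e₂ := v₂.isEquiv_valuation_valuationSubring
  exact e₁.trans (((hw L).2 _ _ _ _ ⟨h₁.val_isEquiv_comap.trans (e₁.comap _)⟩
    ⟨h₂.val_isEquiv_comap.trans (e₂.comap _)⟩).trans e₂.symm)

/-- A root congruent to 1 exists over the algebraic closure. It is unique there, hence Galois
invariant, and being separable it lies in K. -/
theorem IsHenselian.exists_pow_eq {F : Type v₁} [Field F] {Γ₀ : Type*}
    [LinearOrderedCommGroupWithZero Γ₀] {w : Valuation F Γ₀} (hw : IsHenselian w)
    {K : Type v₁} [Field K] [Algebra F K] [Algebra.IsAlgebraic F K] {Γ : Type*}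
    [LinearOrderedCommGroupWithZero Γ] (v : Valuation K Γ) [hv : w.HasExtension v] {N : ℕ}
    (hN : v (N : K) = 1) {a : K} (ha : v (a - 1) < 1) :
    ∃ b : K, b ^ N = a ∧ v (b - 1) < 1 := by
  have hNK : (N : K) ≠ 0 := by rintro h; simp [h] at hN
  have hN0 : N ≠ 0 := by rintro rfl; simp at hNK
  have : Algebra.IsAlgebraic F (AlgebraicClosure K) := Algebra.IsAlgebraic.trans F K _
  obtain ⟨Γ', _, vL, hL⟩ := (hw (AlgebraicClosure K)).1
  set i := algebraMap K (AlgebraicClosure K) with hi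
  have hcomp : i.comp (algebraMap F K) = algebraMap F (AlgebraicClosure K) :=
    (IsScalarTower.algebraMap_eq F K (AlgebraicClosure K)).symm
  have hequiv : v.IsEquiv (vL.comap i) := hw.isEquiv hv ⟨by
    rw [← Valuation.comap_comp, hcomp]; exact hL.val_isEquiv_comap⟩
  have hlt : ∀ x : K, v x < 1 ↔ vL (i x) < 1 := fun x =>
    Valuation.isEquiv_iff_val_lt_one.mp hequiv
  have hNL : vL (N : AlgebraicClosure K) = 1 := by
    have := (Valuation.isEquiv_iff_val_eq_one.mp hequiv).mp hN
    simpa using this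
  have haL : vL (i a - 1) < 1 := by
    rw [← map_one i, ← map_sub, ← hlt]; exact ha
  obtain ⟨b, hb, hb1⟩ := exists_pow_eq_of_isAlgClosed vL hN0 haL
  have hne : ∀ {x : AlgebraicClosure K}, vL (x - 1) < 1 → x ≠ 0 := by
    rintro x hx rfl
    simp at hx
  -- Uniqueness of the extension makes vL invariant under σ up to equivalence, so σ b is again a
  -- root congruent to 1, and σ b / b is an N-th root of unity congruent to 1.
  have hfix : ∀ σ : AlgebraicClosure K ≃ₐ[K] AlgebraicClosure K, σ b = b := by
    intro σ
    have hσ : vL.IsEquiv (vL.comap (σ : AlgebraicClosure K →+* AlgebraicClosure K)) := by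
      refine hw.isEquiv hL ⟨?_⟩
      rw [← Valuation.comap_comp]
      have : (σ : AlgebraicClosure K →+* AlgebraicClosure K).comp
          (algebraMap F (AlgebraicClosure K)) = algebraMap F (AlgebraicClosure K) := by
        ext x
        exact (σ.restrictScalars F).commutes x
      rw [this]
      exact hL.val_isEquiv_comap
    have hσb : vL (σ b - 1) < 1 := by
      have := (Valuation.isEquiv_iff_val_lt_one.mp hσ).mp hb1
      simpa using this
    have hq : Units.mk0 _ (hne hσb) / Units.mk0 _ (hne hb1) = 1 := by
      refine eq_one_of_pow_eq_one vL hNL (div_mem hσb hb1) ?_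
      rw [div_pow, div_eq_one]
      ext
      simp only [Units.val_pow_eq_pow_val, Units.val_mk0]
      rw [← map_pow, hb, hi, σ.commutes]
    exact congrArg Units.val (div_eq_one.mp hq)
  have hsep : IsSeparable K b := by
    have hs : (X ^ N - C a).Separable := separable_X_pow_sub_C a hNK (by
      rintro rfl; simp at ha)
    exact hs.of_dvd (minpoly.dvd K b (by simp [hb, hi]))
  have hmem : b ∈ (⊥ : Subalgebra K (AlgebraicClosure K)) := by
    by_contra hb'
    obtain ⟨y, hy, hc⟩ := (notMem_iff_exists_ne_and_isConjRoot hsep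
      (IsAlgClosed.splits _)).mp hb'
    obtain ⟨σ, hσ⟩ := hc.exists_algEquiv
    exact hy ((hfix σ.symm).symm.trans (σ.symm_apply_eq.mpr hσ.symm))
  obtain ⟨c, rfl⟩ := Algebra.mem_bot.mp hmem
  refine ⟨c, i.injective ?_, ?_⟩
  · rw [map_pow]; exact hb
  · rw [hlt, map_sub, map_one]; exact hb1

variable {F : Type v₁} [Field F] {D : Type v₂} [DivisionRing D] [Algebra F D]

/-- The subfield of `D` generated by `a`, embedded in `D`. -/
theorem exists_field_algHom [FiniteDimensional F D] (a : D) :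
    ∃ (K : Type v₁) (_ : Field K) (_ : Algebra F K) (f : K →ₐ[F] D) (x : K),
      FiniteDimensional F K ∧ Module.finrank F K = (minpoly F a).natDegree ∧ f x = a := by
  have hi : IsIntegral F a := Algebra.IsIntegral.isIntegral a
  have : Fact (Irreducible (minpoly F a)) := ⟨minpoly.irreducible hi⟩
  -- Unlike a subfield of D, this model of F(a) lies in the universe of F, as `IsHenselian` demands.
  refine ⟨AdjoinRoot (minpoly F a), inferInstance, inferInstance,
    Ideal.Quotient.liftₐ (Ideal.span {minpoly F a}) (aeval a) ?_, AdjoinRoot.root _, ?_, ?_, ?_⟩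
  · intro p hp
    obtain ⟨q, rfl⟩ := Ideal.mem_span_singleton.mp hp
    rw [map_mul, minpoly.aeval, zero_mul]
  · exact (AdjoinRoot.powerBasis (minpoly.ne_zero hi)).finite
  · rw [(AdjoinRoot.powerBasis (minpoly.ne_zero hi)).finrank, AdjoinRoot.powerBasis_dim]
  · exact aeval_X a

/-- D is a left vector space over F(a), so the tower law applies. -/
theorem natDegree_minpoly_dvd_finrank [FiniteDimensional F D] (a : D) :
    (minpoly F a).natDegree ∣ Module.finrank F D := by
  obtain ⟨K, _, _, f, x, _, hK, -⟩ := exists_field_algHom (F := F) a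
  let _ : Module K D := Module.compHom D f.toRingHom
  have : IsScalarTower F K D := ⟨fun c x d => by
    change f (c • x) * d = c • (f x * d)
    rw [map_smul, smul_mul_assoc]⟩
  exact ⟨Module.finrank K D, by rw [← hK, Module.finrank_mul_finrank]⟩

/-- Hensel's lemma for `N`-th roots of elements of `1 + M_D`. -/
theorem IsHenselian.exists_pow_eq_of_mem_oneAddMaxIdeal [FiniteDimensional F D] {Γ₀ Γ₁ : Type*}
    [LinearOrderedCommGroupWithZero Γ₀] [LinearOrderedCommGroupWithZero Γ₁] {w : Valuation F Γ₀}
    (hw : IsHenselian w) (v : Valuation D Γ₁) [hv : w.HasExtension v] {N : ℕ}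
    (hN : w (N : F) = 1) {a : Dˣ} (ha : a ∈ oneAddMaxIdeal v) :
    ∃ b ∈ oneAddMaxIdeal v, b ^ N = a := by
  obtain ⟨K, _, _, f, x, _, -, hx⟩ := exists_field_algHom (F := F) (a : D)
  have hext : w.HasExtension (v.comap (f : K →+* D)) := ⟨by
    rw [← Valuation.comap_comp, AlgHom.comp_algebraMap]
    exact hv.val_isEquiv_comap⟩
  have hNK : v.comap (f : K →+* D) (N : K) = 1 := by
    have := (Valuation.HasExtension.val_map_eq_one_iff w (v.comap (f : K →+* D)) (N : F)).mpr hN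
    simpa using this
  have hx1 : v.comap (f : K →+* D) (x - 1) < 1 := by
    simpa [hx] using! ha
  obtain ⟨y, hy, hy1⟩ := hw.exists_pow_eq (v.comap (f : K →+* D)) hNK hx1
  have hy1' : v (f y - 1) < 1 := by simpa using hy1
  have h0 : f y ≠ 0 := by
    intro h
    simp [h] at hy1'
  exact ⟨Units.mk0 _ h0, hy1', Units.ext (by simp [← map_pow, hy, hx])⟩

end Hensel

/-! ### Passing to the quotient by [D^*, 1 + M_D] -/

section Congruence

variable {F : Type*} [Field F] {D : Type*} [DivisionRing D] [Algebra F D]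
  {Γ₀ : Type*} [LinearOrderedCommGroupWithZero Γ₀]
  {Γ₁ : Type*} [LinearOrderedCommGroupWithZero Γ₁]

/-- The value group is commutative, so conjugation preserves v. -/
theorem oneAddMaxIdeal_normal (v : Valuation D Γ₁) : (oneAddMaxIdeal v).Normal where
  conj_mem a ha g := by
    change v (((g * a * g⁻¹ : Dˣ) : D) - 1) < 1
    have h : ((g * a * g⁻¹ : Dˣ) : D) - 1 = g * ((a : D) - 1) * (g⁻¹ : Dˣ) := by
      rw [mul_sub, sub_mul, mul_one, Units.mul_inv]
      simp
    have hg : v (g : D) ≠ 0 := v.ne_zero_iff.mpr g.ne_zero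
    rw [h, map_mul, map_mul, mul_right_comm, ← map_mul, Units.mul_inv, map_one, one_mul]
    exact ha

theorem commutator_oneAddMaxIdeal_normal (v : Valuation D Γ₁) :
    (⁅(⊤ : Subgroup Dˣ), oneAddMaxIdeal v⁆ : Subgroup Dˣ).Normal :=
  have := oneAddMaxIdeal_normal v
  Subgroup.commutator_normal _ _

theorem map_mem_oneAddMaxIdeal_iff (w : Valuation F Γ₀) (v : Valuation D Γ₁)
    [w.HasExtension v] {c : Fˣ} :
    Units.map (algebraMap F D : F →* D) c ∈ oneAddMaxIdeal v ↔ c ∈ oneAddMaxIdeal w := by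
  change v (algebraMap F D c - 1) < 1 ↔ w ((c : F) - 1) < 1
  rw [← Valuation.HasExtension.val_map_lt_one_iff w v,
    map_sub (algebraMap F D), map_one (algebraMap F D)]

variable (F D) in
theorem finrank_eq_index_mul_index [Algebra.IsCentral F D] [FiniteDimensional F D] :
    Module.finrank F D = index F D * index F D := by
  obtain ⟨e⟩ := exists_splitting F D
  rw [← Module.finrank_baseChange (R := AlgebraicClosure F), e.toLinearEquiv.finrank_eq,
    Module.finrank_matrix]
  simp

/-- A central element becomes a scalar matrix of size the index. -/
theorem reducedNorm_algebraMap [Algebra.IsCentral F D] [FiniteDimensional F D] (c : F) :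
    reducedNorm F D (algebraMap F D c) = algebraMap F (AlgebraicClosure F) c ^ index F D := by
  set e := Classical.choice (exists_splitting F D)
  have h : e ((1 : AlgebraicClosure F) ⊗ₜ[F] algebraMap F D c) =
      algebraMap (AlgebraicClosure F) _ (algebraMap F (AlgebraicClosure F) c) := by
    rw [← e.commutes]
    congr 1
    rw [Algebra.TensorProduct.algebraMap_apply, Algebra.algebraMap_self, RingHom.id_apply,
      Algebra.algebraMap_eq_smul_one, Algebra.algebraMap_eq_smul_one, TensorProduct.tmul_smul,
      TensorProduct.smul_tmul']
  change Matrix.det (e ((1 : AlgebraicClosure F) ⊗ₜ[F] algebraMap F D c)) = _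
  rw [h, Matrix.algebraMap_eq_diagonal, Matrix.det_diagonal]
  simp

/-- If the residue characteristic does not divide the index, then the index is a unit of the
valuation ring. -/
theorem IsTame.val_index_eq_one {w : Valuation F Γ₀} {v : Valuation D Γ₁} [w.HasExtension v]
    (h : IsTame w v) : w (index F D : F) = 1 := by
  have h1 : ((index F D : ℕ) : Residue w) ≠ 0 := fun h0 => h.2 (ringChar.dvd h0)
  have hle : w (index F D : F) ≤ 1 := ((index F D : ℕ) : w.integer).2
  refine le_antisymm hle (not_lt.mp fun hlt => h1 ?_)
  rw [← map_natCast (Ideal.Quotient.mk (maxIdeal w))]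
  exact Ideal.Quotient.eq_zero_iff_mem.mpr hlt

/-- A power of every element of `1 + M_D` is, modulo `[D^*, 1 + M_D]`, an element of `1 + M_F`;
the exponent is the degree over `F`. -/
theorem exists_pow_natDegree_div_mem [Algebra.IsCentral F D] [FiniteDimensional F D]
    (w : Valuation F Γ₀) (v : Valuation D Γ₁) [w.HasExtension v] {a : Dˣ}
    (ha : a ∈ oneAddMaxIdeal v) :
    ∃ c ∈ oneAddMaxIdeal w, (Units.map (algebraMap F D : F →* D) c)⁻¹ *
      a ^ (minpoly F (a : D)).natDegree ∈ ⁅(⊤ : Subgroup Dˣ), oneAddMaxIdeal v⁆ := by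
  have hG := oneAddMaxIdeal_normal v
  have hH := commutator_oneAddMaxIdeal_normal v
  obtain ⟨l, c, hl, hc⟩ := exists_prod_conj_eq_algebraMap (F := F) a
  have hc0 : c ≠ 0 := by
    rintro rfl
    rw [map_zero] at hc
    exact Units.ne_zero _ hc
  have hcu : Units.map (algebraMap F D : F →* D) (Units.mk0 c hc0) =
      (l.map fun u => u * a * u⁻¹).prod := Units.ext hc.symm
  refine ⟨Units.mk0 c hc0, ?_, ?_⟩
  · rw [← map_mem_oneAddMaxIdeal_iff w v, hcu]
    refine Subgroup.list_prod_mem _ fun x hx => ?_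
    obtain ⟨u, -, rfl⟩ := List.mem_map.mp hx
    exact hG.conj_mem a ha u
  · rw [hcu, ← QuotientGroup.eq, ← hl]
    change QuotientGroup.mk' _ _ = QuotientGroup.mk' _ _
    rw [map_list_prod, List.map_map, map_pow]
    refine (List.prod_eq_pow_card _ (QuotientGroup.mk' _ a) ?_).trans (by rw [List.length_map])
    -- Each factor u a u⁻¹ has the class of a, since the two differ by a conjugate of the commutator
    -- of u and a.
    intro x hx
    obtain ⟨u, -, rfl⟩ := List.mem_map.mp hx
    rw [Function.comp_apply, eq_comm]
    refine QuotientGroup.eq.mpr ?_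
    have := Subgroup.commutator_mem_commutator (Subgroup.mem_top u) ha
    have := hH.conj_mem _ this a⁻¹
    simpa [commutatorElement_def, mul_assoc] using this

end Congruence

end ValuedDivision

open ValuedDivision in
theorem mainTheorem8 {F : Type*} [Field F] {D : Type*} [DivisionRing D] [Algebra F D]
    [Algebra.IsCentral F D] [FiniteDimensional F D]
    {Γ₀ : Type*} [LinearOrderedCommGroupWithZero Γ₀]
    {Γ₁ : Type*} [LinearOrderedCommGroupWithZero Γ₁]
    (w : Valuation F Γ₀) (hw : ValuedDivision.IsHenselian w)
    (v : Valuation D Γ₁) [w.HasExtension v] (htame : ValuedDivision.IsTame w v) :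
    ((ValuedDivision.oneAddMaxIdeal v : Set Dˣ) =
      ((ValuedDivision.oneAddMaxIdeal w).map (Units.map (algebraMap F D : F →* D)) : Set Dˣ) *
        ((⁅(⊤ : Subgroup Dˣ), ValuedDivision.oneAddMaxIdeal v⁆ : Subgroup Dˣ) : Set Dˣ)) ∧
    ValuedDivision.oneAddMaxIdeal v ⊓ ValuedDivision.reducedNormKer F D =
      ⁅(⊤ : Subgroup Dˣ), ValuedDivision.oneAddMaxIdeal v⁆ := by
  have hG := oneAddMaxIdeal_normal v
  have hH := commutator_oneAddMaxIdeal_normal v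
  have hn := htame.val_index_eq_one
  have hHG : ⁅(⊤ : Subgroup Dˣ), oneAddMaxIdeal v⁆ ≤ oneAddMaxIdeal v :=
    Subgroup.commutator_le_right _ _
  have hHN : ⁅(⊤ : Subgroup Dˣ), oneAddMaxIdeal v⁆ ≤ reducedNormKer F D := by
    rw [Subgroup.commutator_le]
    intro g _ h _
    rw [reducedNormKer, MonoidHom.mem_ker, map_commutatorElement,
      commutatorElement_eq_one_iff_mul_comm, mul_comm]
  have key : ∀ a ∈ oneAddMaxIdeal v, ∃ c ∈ oneAddMaxIdeal w,
      (Units.map (algebraMap F D : F →* D) c)⁻¹ * a ∈ ⁅(⊤ : Subgroup Dˣ), oneAddMaxIdeal v⁆ := by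
    intro a ha
    -- Roots of order [D : F] = n^2 are extracted, rather than of order n, because the tower law
    -- alone shows that the degree of b divides n^2.
    have hN : w (Module.finrank F D : F) = 1 := by
      rw [finrank_eq_index_mul_index, Nat.cast_mul, map_mul, hn, one_mul]
    obtain ⟨b, hb, rfl⟩ := hw.exists_pow_eq_of_mem_oneAddMaxIdeal v hN ha
    obtain ⟨k, hk⟩ := natDegree_minpoly_dvd_finrank (F := F) (b : D)
    obtain ⟨c, hc, hcb⟩ := exists_pow_natDegree_div_mem w v hb
    refine ⟨c ^ k, pow_mem hc k, ?_⟩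
    rw [← QuotientGroup.eq] at hcb ⊢
    rw [hk, pow_mul, map_pow, QuotientGroup.mk_pow, hcb, ← QuotientGroup.mk_pow]
  refine ⟨Set.Subset.antisymm ?_ ?_, le_antisymm ?_ (le_inf hHG hHN)⟩
  · intro a ha
    obtain ⟨c, hc, hca⟩ := key a ha
    exact ⟨_, ⟨c, hc, rfl⟩, _, hca, mul_inv_cancel_left _ _⟩
  · rintro _ ⟨_, ⟨c, hc, rfl⟩, h, hh, rfl⟩
    exact mul_mem ((map_mem_oneAddMaxIdeal_iff w v).mpr hc) (hHG hh)
  · rintro a ⟨ha, haN⟩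
    obtain ⟨c, hc, hca⟩ := key a ha
    -- Here a = c h with h in the commutator subgroup, so c = a h⁻¹ has reduced norm 1.
    have hcN : Units.map (algebraMap F D : F →* D) c ∈ reducedNormKer F D := by
      have := (reducedNormKer F D).mul_mem haN (inv_mem (hHN hca))
      simpa using this
    have hcn : c ^ index F D = 1 := by
      have h1 := congrArg Units.val hcN
      refine Units.ext ((algebraMap F (AlgebraicClosure F)).injective ?_)
      rw [Units.val_pow_eq_pow_val, map_pow, ← reducedNorm_algebraMap]
      simpa using h1
    rw [eq_one_of_pow_eq_one w hn hc hcn] at hca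
    simpa using hca
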